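/- Let $\mathfrak g$ be a Lie algebra over $\mathbf R$, equipped with a topology for which addition and negation are continuous and the bracket $\mathfrak g\times\mathfrak g\to\mathfrak g$ is jointly continuous. Assume that either (a) the topology is discrete (i.e. $\mathfrak g$ is an arbitrary real Lie algebra without further topological structure, and every cochain counts as continuous), or (b) every neighbourhood of $0$ in $\mathfrak g$ contains a linear subspace of finite codimension (for instance $\mathfrak g$ finite-dimensional with its usual topology, or the formal vector fields $W_1=\{\sum_{k\ge 0}c_kx^k\frac{d}{dx}\}$ with the topology given by powers of the maximal ideal of $\mathbf R[[x]]$). *Leibniz cohomology.* For $n\ge 0$ let $C^n(\mathfrak g)=\mathrm{Hom}^c_{\mathbf R}(\mathfrak g^{\otimes n},\mathbf R)$ be the space of (jointly) continuous $n$-linear forms on $\mathfrak g$, with $$(d\alpha)(g_1,\dots,g_{n+1})=\sum_{1\le i<j\le n+1}(-1)^{j+1}\alpha(g_1,\dots,g_{i-1},[g_i,g_j],g_{i+1},\dots,\hat g_j,\dots,g_{n+1}),$$ and let $HL^n(\mathfrak g)$ be the $n$-th cohomology of $(C^*(\mathfrak g),d)$. *Lie algebra cohomology.* Let $\mathfrak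 g'=\mathrm{Hom}^c_{\mathbf R}(\mathfrak g,\mathbf R)$ be the coadjoint module, $(g\gamma)(h)=\gamma([h,g])$. For $n\ge 0$ let $\Omega^n(\mathfrak g;\mathfrak g')$ be the space of skew-symmetric $n$-linear maps $\beta:\mathfrak g^n\to\mathfrak g'$ for which $(g_0,g_1,\dots,g_n)\mapsto\beta(g_1,\dots,g_n)(g_0)$ is continuous on $\mathfrak g^{n+1}$, with the Chevalley–Eilenberg coboundary $$(d\beta)(g_1,\dots,g_{n+1})=\sum_{j=1}^{n+1}(-1)^{j+1}g_j\,\beta(g_1,\dots,\hat g_j,\dots,g_{n+1})+\sum_{1\le i<j\le n+1}(-1)^{j+1}\beta(g_1,\dots,g_{i-1},[g_i,g_j],g_{i+1},\dots,\hat g_j,\dots,g_{n+1}),$$ and let $H^n_{\mathrm{Lie}}(\mathfrak g;\mathfrak g')$ be the $n$-th cohomology of this complex. **Theorem.** If $HL^n(\mathfrak g)=0$ for all $n\ge 1$, then $H^{n-1}_{\mathrm{Lie}}(\mathfrak g;\mathfrak g')=0$ for all $n\ge 1$. -/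

import Mathlib

open Topology

noncomputable section

/-- The Lie bracket of a topological Lie algebra is jointly continuous. -/
class ContinuousLieBracket (g : Type*) [LieRing g] [TopologicalSpace g] : Prop where
  continuous_lie : Continuous fun p : g × g => ⁅p.1, p.2⁆

namespace LieLeibniz

section Algebraic

variable {g : Type*} [LieRing g] [LieAlgebra ℝ g]
variable {N : Type*} [AddCommGroup N] [Module ℝ N]

/-- For `i < j` (here `i : Fin n` and `i.castSucc < j`), the multilinear map
`(x₀, …, xₙ) ↦ α (x₀, …, xᵢ₋₁, [xᵢ, xⱼ], xᵢ₊₁, …, x̂ⱼ, …, xₙ)`, with `xⱼ` omitted. -/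
def bracketTerm {n : ℕ} (α : MultilinearMap ℝ (fun _ : Fin n => g) N)
    (j : Fin (n + 1)) (i : Fin n) (hij : i.castSucc < j) :
    MultilinearMap ℝ (fun _ : Fin (n + 1) => g) N :=
  MultilinearMap.mk'
    (fun x => α (Function.update (j.removeNth x) i ⁅x i.castSucc, x j⁆))
    (by
      have hi : j.succAbove i = i.castSucc := Fin.succAbove_of_castSucc_lt _ _ hij
      intro m c x y
      rcases Fin.eq_self_or_eq_succAbove j c with rfl | ⟨c, rfl⟩
      · simp [Fin.removeNth_update, Function.update_of_ne hij.ne]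
      · by_cases hc : c = i
        · subst hc
          simp [Fin.removeNth_update_succAbove, ← hi]
        · have h1 : j.succAbove i ≠ j.succAbove c := fun h =>
            hc (Fin.succAbove_right_injective h).symm
          simp [Fin.removeNth_update_succAbove, ← hi, h1, Function.update_comm hc])
    (by
      have hi : j.succAbove i = i.castSucc := Fin.succAbove_of_castSucc_lt _ _ hij
      intro m c r x
      rcases Fin.eq_self_or_eq_succAbove j c with rfl | ⟨c, rfl⟩
      · simp [Fin.removeNth_update, Function.update_of_ne hij.ne]
      · by_cases hc : c = i
        · subst hc
          simp [Fin.removeNth_update_succAbove, ← hi]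
        · have h1 : j.succAbove i ≠ j.succAbove c := fun h =>
            hc (Fin.succAbove_right_injective h).symm
          simp [Fin.removeNth_update_succAbove, ← hi, h1, Function.update_comm hc])

/-- The bracket part of the coboundary,
`(x₀, …, xₙ) ↦ ∑_{i < j} (-1)ʲ α (x₀, …, xᵢ₋₁, [xᵢ, xⱼ], xᵢ₊₁, …, x̂ⱼ, …, xₙ)`.
With arguments numbered from `1`, the sign is `(-1)^(j+1)`. -/
def bracketD {n : ℕ} (α : MultilinearMap ℝ (fun _ : Fin n => g) N) :
    MultilinearMap ℝ (fun _ : Fin (n + 1) => g) N :=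
  ∑ j : Fin (n + 1), ∑ i : Fin n,
    if hij : i.castSucc < j then (-1 : ℝ) ^ (j : ℕ) • bracketTerm α j i hij else 0

theorem bracketD_apply {n : ℕ} (α : MultilinearMap ℝ (fun _ : Fin n => g) N)
    (x : Fin (n + 1) → g) :
    bracketD α x = ∑ j : Fin (n + 1), ∑ i : Fin n,
      if i.castSucc < j then
        (-1 : ℝ) ^ (j : ℕ) • α (Function.update (j.removeNth x) i ⁅x i.castSucc, x j⁆)
      else 0 := by
  simp only [bracketD, sum_apply]
  refine Finset.sum_congr rfl fun j _ => Finset.sum_congr rfl fun i _ => ?_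
  split_ifs <;> rfl

/-- For a linear map `ρ : g → End N`, the action part of the coboundary,
`(x₀, …, xₙ) ↦ ∑ⱼ (-1)ʲ ρ(xⱼ) (β (x₀, …, x̂ⱼ, …, xₙ))`. -/
def actionD (ρ : g →ₗ[ℝ] N →ₗ[ℝ] N) {n : ℕ} (β : MultilinearMap ℝ (fun _ : Fin n => g) N) :
    MultilinearMap ℝ (fun _ : Fin (n + 1) => g) N :=
  ∑ j : Fin (n + 1), (-1 : ℝ) ^ (j : ℕ) •
    MultilinearMap.mk' (fun x => ρ (x j) (β (j.removeNth x)))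
      (by
        intro m c x y
        rcases Fin.eq_self_or_eq_succAbove j c with rfl | ⟨c, rfl⟩
        · simp [Fin.removeNth_update]
        · simp [Fin.removeNth_update_succAbove, (Fin.succAbove_ne j c).symm])
      (by
        intro m c r x
        rcases Fin.eq_self_or_eq_succAbove j c with rfl | ⟨c, rfl⟩
        · simp [Fin.removeNth_update]
        · simp [Fin.removeNth_update_succAbove, (Fin.succAbove_ne j c).symm])

theorem actionD_apply (ρ : g →ₗ[ℝ] N →ₗ[ℝ] N) {n : ℕ}
    (β : MultilinearMap ℝ (fun _ : Fin n => g) N) (x : Fin (n + 1) → g) :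
    actionD ρ β x = ∑ j : Fin (n + 1), (-1 : ℝ) ^ (j : ℕ) • ρ (x j) (β (j.removeNth x)) := by
  simp [actionD]

theorem bracketD_add {n : ℕ} (α β : MultilinearMap ℝ (fun _ : Fin n => g) N) :
    bracketD (α + β) = bracketD α + bracketD β := by
  refine MultilinearMap.ext fun x => ?_
  rw [add_apply]
  simp only [bracketD_apply, ← Finset.sum_add_distrib]
  refine Finset.sum_congr rfl fun j _ => Finset.sum_congr rfl fun i _ => ?_
  split_ifs <;> simp

theorem bracketD_smul {n : ℕ} (r : ℝ) (α : MultilinearMap ℝ (fun _ : Fin n => g) N) :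
    bracketD (r • α) = r • bracketD α := by
  refine MultilinearMap.ext fun x => ?_
  rw [smul_apply]
  simp only [bracketD_apply, Finset.smul_sum]
  refine Finset.sum_congr rfl fun j _ => Finset.sum_congr rfl fun i _ => ?_
  split_ifs
  · simp [smul_comm r]
  · simp

theorem actionD_add (ρ : g →ₗ[ℝ] N →ₗ[ℝ] N) {n : ℕ}
    (α β : MultilinearMap ℝ (fun _ : Fin n => g) N) :
    actionD ρ (α + β) = actionD ρ α + actionD ρ β := by
  refine MultilinearMap.ext fun x => ?_
  rw [add_apply]
  simp only [actionD_apply, ← Finset.sum_add_distrib]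
  exact Finset.sum_congr rfl fun j _ => by simp

theorem actionD_smul (ρ : g →ₗ[ℝ] N →ₗ[ℝ] N) {n : ℕ} (r : ℝ)
    (α : MultilinearMap ℝ (fun _ : Fin n => g) N) :
    actionD ρ (r • α) = r • actionD ρ α := by
  refine MultilinearMap.ext fun x => ?_
  rw [smul_apply]
  simp only [actionD_apply, Finset.smul_sum]
  exact Finset.sum_congr rfl fun j _ => by simp [smul_comm r]

end Algebraic

/-- The quotient `Z / B` of the cocycles by the coboundaries, for submodules `B` (coboundaries)
and `Z` (cocycles) of a space of cochains; here `B` is intersected with `Z`. -/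
abbrev CohomologyQuotient {C : Type*} [AddCommGroup C] [Module ℝ C] (Z B : Submodule ℝ C) :
    Type _ :=
  Z ⧸ B.submoduleOf Z

variable (g : Type*) [LieRing g] [LieAlgebra ℝ g] [TopologicalSpace g] [ContinuousLieBracket g]

/-! ### Leibniz cohomology with trivial real coefficients -/

/-- `Cⁿ(g) = Hom^c(g^{⊗n}, ℝ)`: the continuous `n`-linear forms on `g`. -/
abbrev LeibnizCochain (g : Type*) [LieRing g] [LieAlgebra ℝ g] [TopologicalSpace g] (n : ℕ) :
    Type _ :=
  ContinuousMultilinearMap ℝ (fun _ : Fin n => g) ℝ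

/-- The Leibniz coboundary `Cⁿ(g) → Cⁿ⁺¹(g)`. -/
def leibnizD (n : ℕ) : LeibnizCochain g n →ₗ[ℝ] LeibnizCochain g (n + 1) where
  toFun α :=
    { toMultilinearMap := bracketD α.toMultilinearMap
      cont := by
        have h : Continuous fun x : Fin (n + 1) → g => bracketD α.toMultilinearMap x := by
          simp only [bracketD_apply]
          refine continuous_finsetSum _ fun j _ => continuous_finsetSum _ fun i _ => ?_
          split_ifs
          · have hc : Continuous fun x : Fin (n + 1) → g =>
                α (Function.update (j.removeNth x) i ⁅x i.castSucc, x j⁆) := by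
              refine α.cont.comp (Continuous.update ?_ i ?_)
              · exact continuous_pi fun k => continuous_apply (j.succAbove k)
              · have hp : Continuous fun x : Fin (n + 1) → g => (x i.castSucc, x j) :=
                  (continuous_apply i.castSucc).prodMk (continuous_apply j)
                exact ContinuousLieBracket.continuous_lie.comp hp
            exact hc.const_smul ((-1 : ℝ) ^ (j : ℕ))
          · exact continuous_const
        exact h }
  map_add' α β := ContinuousMultilinearMap.toMultilinearMap_injective
    (bracketD_add α.toMultilinearMap β.toMultilinearMap)
  map_smul' r α := ContinuousMultilinearMap.toMultilinearMap_injective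
    (bracketD_smul r α.toMultilinearMap)

/-- Leibniz cocycles of degree `n`. -/
def leibnizCocycles (n : ℕ) : Submodule ℝ (LeibnizCochain g n) :=
  LinearMap.ker (leibnizD g n)

/-- Leibniz coboundaries of degree `n`. -/
def leibnizCoboundaries : (n : ℕ) → Submodule ℝ (LeibnizCochain g n)
  | 0 => ⊥
  | n + 1 => LinearMap.range (leibnizD g n)

/-- The Leibniz cohomology `HLⁿ(g) = HLⁿ(g; ℝ)`. -/
abbrev LeibnizCohomology (n : ℕ) : Type _ :=
  CohomologyQuotient (leibnizCocycles g n) (leibnizCoboundaries g n)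

/-! ### Lie algebra cohomology with coefficients in the coadjoint module -/

/-- The continuous dual `g' = Hom^c(g, ℝ)`. -/
abbrev ContDual (g : Type*) [LieRing g] [LieAlgebra ℝ g] [TopologicalSpace g] : Type _ :=
  g →L[ℝ] ℝ

/-- The coadjoint action of `g` on `g'`: `(x γ)(h) = γ([h, x])`. -/
def coadjoint : g →ₗ[ℝ] ContDual g →ₗ[ℝ] ContDual g :=
  LinearMap.mk₂ ℝ
    (fun x γ =>
      { toFun := fun h => γ ⁅h, x⁆
        map_add' := fun a b => by simp
        map_smul' := fun r a => by simp
        cont := γ.continuous.comp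
          ((ContinuousLieBracket.continuous_lie (g := g)).comp (continuous_id.prodMk continuous_const)) })
    (fun x y γ => by ext h; simp)
    (fun r x γ => by ext h; simp)
    (fun x γ δ => by ext h; simp)
    (fun r x γ => by ext h; simp)

/-- `Ωⁿ(g; g')`: the skew-symmetric `n`-linear maps `β : gⁿ → g'` that are continuous, in the
sense that `(h, x₁, …, xₙ) ↦ β (x₁, …, xₙ) (h)` is a continuous function on `gⁿ⁺¹`. -/
def lieCochains (n : ℕ) : Submodule ℝ (g [⋀^Fin n]→ₗ[ℝ] ContDual g) where
  carrier := {β | Continuous fun p : g × (Fin n → g) => β p.2 p.1}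
  add_mem' {a b} ha hb := by
    exact Continuous.add (show Continuous fun p : g × (Fin n → g) => a p.2 p.1 from ha) hb
  zero_mem' := by simpa using continuous_const
  smul_mem' r a ha := by
    exact Continuous.const_smul (show Continuous fun p : g × (Fin n → g) => a p.2 p.1 from ha) r

/-- The Chevalley–Eilenberg coboundary
`(dβ)(x₀, …, xₙ) = ∑ⱼ (-1)ʲ xⱼ β(…, x̂ⱼ, …) + ∑_{i < j} (-1)ʲ β(…, [xᵢ, xⱼ], …, x̂ⱼ, …)`,
where `[xᵢ, xⱼ]` stands in the place of `xᵢ`. -/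
def lieD (n : ℕ) : (g [⋀^Fin n]→ₗ[ℝ] ContDual g) →ₗ[ℝ]
    MultilinearMap ℝ (fun _ : Fin (n + 1) => g) (ContDual g) where
  toFun β := actionD (coadjoint g) β.toMultilinearMap + bracketD β.toMultilinearMap
  map_add' α β := by
    rw [show (α + β).toMultilinearMap = α.toMultilinearMap + β.toMultilinearMap from rfl,
      actionD_add, bracketD_add, add_add_add_comm]
  map_smul' r α := by
    rw [show (r • α).toMultilinearMap = r • α.toMultilinearMap from rfl,
      actionD_smul, bracketD_smul, RingHom.id_apply, smul_add]

/-- The cocycles in `Ωⁿ(g; g')`. -/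
def lieCocycles (n : ℕ) : Submodule ℝ (g [⋀^Fin n]→ₗ[ℝ] ContDual g) :=
  lieCochains g n ⊓ LinearMap.ker (lieD g n)

/-- The coboundaries in `Ωⁿ(g; g')`: zero for `n = 0`, and for `n = m + 1` those `β` which are
`dγ` for some cochain `γ ∈ Ωᵐ(g; g')`. -/
def lieCoboundaries : (n : ℕ) → Submodule ℝ (g [⋀^Fin n]→ₗ[ℝ] ContDual g)
  | 0 => ⊥
  | n + 1 => ((lieCochains g n).map (lieD g n)).comap AlternatingMap.toMultilinearMapLM

/-- The Lie algebra cohomology `Hⁿ_Lie(g; g')` with coefficients in the coadjoint module. -/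
abbrev LieCohomologyCoadjoint (n : ℕ) : Type _ :=
  CohomologyQuotient (C := g [⋀^Fin n]→ₗ[ℝ] ContDual g) (lieCocycles g n) (lieCoboundaries g n)

end LieLeibniz

end

/-! Reading `β(x₁,…,xₙ)(h)` as a form in `(h,x₁,…,xₙ)` embeds the coadjoint complex, shifted by one
degree and up to sign, into the Leibniz complex (`formD_toForm`). Its image consists of the
continuous forms that are skew in all arguments but the first (`exists_toForm_eq`). It must be shown
that acyclicity passes from all continuous forms to these.

Skewness is imposed one adjacent pair at a time, from the end (`skewLast`). Let `e` be a primitive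
of a cocycle, where the cocycle is skew in one more pair than `e`. If the new pair is the last one,
symmetrizing it commutes with `d`, so the symmetrization of `e` is a cocycle and hence `d T` of
itself, with `T` a linear splitting. Applying `T` with these two arguments as parameters gives a
form whose coboundary, subtracted from `e`, kills the symmetrization and leaves `d e` unchanged.
Later arguments are also kept as parameters; inserting them costs only `theta` terms, which preserve
skewness (`sub_formD_liftForm_mem_skewLast`, `exists_formD_eq_of_mem_skewLast`).

The topology matters only because `T` is chosen by pure linear algebra, so the parametrized `T` must
be shown to preserve joint continuity. Discreteness makes this trivial. Otherwise a continuous form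
factors through a finite-dimensional quotient (`exists_eq_compLinearMap_mkQ`), and `T` acts on a
finite-dimensional space of forms. -/

namespace LieLeibniz

/-! ### Cartan calculus for insertion into the last argument. -/

section LastArgument

variable {g : Type*} [LieRing g] [LieAlgebra ℝ g]

/-- The `n`-linear real forms on `g`, without continuity condition. -/
abbrev Form (g : Type*) [LieRing g] [LieAlgebra ℝ g] (n : ℕ) : Type _ :=
  MultilinearMap ℝ (fun _ : Fin n => g) ℝ

/-- Insertion of a vector as the last argument of a form. -/
def insertLast {n : ℕ} : g →ₗ[ℝ] Form g (n + 1) →ₗ[ℝ] Form g n :=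
  LinearMap.mk₂ ℝ
    (fun y α => (LinearMap.applyₗ y : (g →ₗ[ℝ] ℝ) →ₗ[ℝ] ℝ).compMultilinearMap α.curryRight)
    (fun y z α => by ext x; simp)
    (fun r y α => by ext x; simp)
    (fun y α β => by ext x; simp)
    (fun r y α => by ext x; simp)

@[simp]
theorem insertLast_apply {n : ℕ} (y : g) (α : Form g (n + 1)) (x : Fin n → g) :
    insertLast y α x = α (Fin.snoc x y) := rfl

theorem apply_eq_insertLast {n : ℕ} (α : Form g (n + 1)) (x : Fin (n + 1) → g) :
    α x = insertLast (x (Fin.last n)) α (Fin.init x) := by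
  rw [insertLast_apply, Fin.snoc_init_self]

theorem ext_insertLast {n : ℕ} {α β : Form g (n + 1)}
    (h : ∀ y, insertLast y α = insertLast y β) : α = β :=
  MultilinearMap.ext fun x => by rw [apply_eq_insertLast α, apply_eq_insertLast β, h]

/-- The form whose last argument is the argument of a linear family of forms. -/
def ofInsertLast {n : ℕ} : (g →ₗ[ℝ] Form g n) →ₗ[ℝ] Form g (n + 1) where
  toFun L :=
    MultilinearMap.mk' (fun x => L (x (Fin.last n)) (Fin.init x))
      (by
        intro m c x y
        refine Fin.lastCases ?_ (fun c => ?_) c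
        · simp [Fin.init_update_last]
        · simp [Fin.init_update_castSucc, (Fin.castSucc_lt_last c).ne'])
      (by
        intro m c r x
        refine Fin.lastCases ?_ (fun c => ?_) c
        · simp [Fin.init_update_last]
        · simp [Fin.init_update_castSucc, (Fin.castSucc_lt_last c).ne'])
  map_add' L M := by ext x; simp
  map_smul' r L := by ext x; simp

theorem ofInsertLast_apply {n : ℕ} (L : g →ₗ[ℝ] Form g n) (x : Fin (n + 1) → g) :
    ofInsertLast L x = L (x (Fin.last n)) (Fin.init x) := rfl

@[simp]
theorem insertLast_ofInsertLast {n : ℕ} (y : g) (L : g →ₗ[ℝ] Form g n) :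
    insertLast y (ofInsertLast L) = L y := by
  ext x; simp [ofInsertLast_apply]

/-- The action of `y` on forms, `(x₁, …, xₙ) ↦ ∑ᵢ α (x₁, …, [xᵢ, y], …, xₙ)`. -/
def theta {n : ℕ} (y : g) : Form g n →ₗ[ℝ] Form g n where
  toFun α := ∑ i : Fin n, α.compLinearMap
    (Function.update (fun _ => LinearMap.id) i (-(LieModule.toEnd ℝ g g y)))
  map_add' α β := by ext x; simp [Finset.sum_add_distrib]
  map_smul' r α := by ext x; simp [Finset.mul_sum]

theorem theta_apply {n : ℕ} (y : g) (α : Form g n) (x : Fin n → g) :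
    theta y α x = ∑ i : Fin n, α (Function.update x i ⁅x i, y⁆) := by
  simp only [theta, LinearMap.coe_mk, AddHom.coe_mk, sum_apply,
    MultilinearMap.compLinearMap_apply]
  refine Finset.sum_congr rfl fun i _ => congrArg α (funext fun k => ?_)
  rcases eq_or_ne k i with rfl | hk
  · simp
  · simp [hk]

@[simp]
theorem theta_form_zero (y : g) (α : Form g 0) : theta y α = 0 := by
  ext x; simp [theta_apply]

theorem insertLast_theta {n : ℕ} (y z : g) (α : Form g (n + 1)) :
    insertLast z (theta y α) = theta y (insertLast z α) + insertLast ⁅z, y⁆ α := by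
  ext x
  simp [theta_apply, Fin.sum_univ_castSucc, Fin.snoc_update, Fin.update_snoc_last]

/-- The bracket part of the coboundary, as a linear map on forms. -/
def formD {n : ℕ} : Form g n →ₗ[ℝ] Form g (n + 1) where
  toFun := bracketD
  map_add' := bracketD_add
  map_smul' := bracketD_smul

theorem formD_apply {n : ℕ} (α : Form g n) (x : Fin (n + 1) → g) :
    formD α x = ∑ j : Fin (n + 1), ∑ i : Fin n,
      if i.castSucc < j then
        (-1 : ℝ) ^ (j : ℕ) • α (Function.update (j.removeNth x) i ⁅x i.castSucc, x j⁆)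
      else 0 :=
  bracketD_apply α x

@[simp]
theorem formD_form_zero (α : Form g 0) : formD α = 0 := by
  ext x; simp [formD_apply]

theorem removeNth_castSucc_snoc {A : Type*} {n : ℕ} (j : Fin (n + 1)) (x : Fin (n + 1) → A)
    (y : A) : j.castSucc.removeNth (Fin.snoc x y : Fin (n + 2) → A)
      = (Fin.snoc (j.removeNth x) y : Fin (n + 1) → A) := by
  funext k
  refine Fin.lastCases ?_ (fun k => ?_) k
  · simp [Fin.removeNth]
  · simp [Fin.removeNth, Fin.castSucc_succAbove_castSucc]

theorem removeNth_succ_cons {A : Type*} {n : ℕ} (j : Fin (n + 1)) (x : Fin (n + 1) → A)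
    (h : A) : j.succ.removeNth (Fin.cons h x : Fin (n + 2) → A)
      = (Fin.cons h (j.removeNth x) : Fin (n + 1) → A) := by
  funext k
  refine Fin.cases ?_ (fun k => ?_) k
  · simp [Fin.removeNth]
  · simp [Fin.removeNth]

/-- Cartan formula: the terms that omit the last argument `y` make up `theta y`, and all others keep
`y` in last place. With `ext_insertLast` it turns the identities below into inductions on the
degree. -/
theorem insertLast_formD {n : ℕ} (y : g) (α : Form g (n + 1)) :
    insertLast y (formD α) = formD (insertLast y α) + (-1 : ℝ) ^ (n + 1) • theta y α := by
  ext x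
  rw [insertLast_apply, formD_apply, Fin.sum_univ_castSucc]
  simp only [add_apply, smul_apply, formD_apply, theta_apply]
  congr 1
  · refine Finset.sum_congr rfl fun j _ => ?_
    rw [Fin.sum_univ_castSucc]
    have h : ¬ (Fin.last n).castSucc < j.castSucc := by
      simpa using Fin.le_last j
    simp [h, removeNth_castSucc_snoc, Fin.snoc_update]
  · simp [Finset.mul_sum, Fin.castSucc_lt_last]

theorem theta_theta_sub {n : ℕ} (y z : g) (α : Form g n) :
    theta y (theta z α) - theta z (theta y α) = theta ⁅y, z⁆ α := by
  induction n with
  | zero => simp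
  | succ n ih =>
    refine ext_insertLast fun w => ?_
    -- The Jacobi identity, for the slot filled by `w`.
    have hj : ⁅⁅w, y⁆, z⁆ = ⁅w, ⁅y, z⁆⁆ + ⁅⁅w, z⁆, y⁆ := by
      rw [lie_lie, ← lie_skew y ⁅w, z⁆, sub_neg_eq_add]
    simp only [map_sub, insertLast_theta, map_add, ← ih (insertLast w α), hj,
      LinearMap.add_apply]
    abel

theorem formD_theta {n : ℕ} (z : g) (α : Form g n) :
    formD (theta z α) = theta z (formD α) := by
  induction n with
  | zero => simp
  | succ n ih =>
    refine ext_insertLast fun y => ?_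
    simp only [insertLast_formD, insertLast_theta, map_add, map_smul, ih,
      ← theta_theta_sub y z α, smul_sub]
    abel

theorem formD_formD {n : ℕ} (α : Form g n) : formD (formD α) = 0 := by
  induction n with
  | zero => simp
  | succ n ih =>
    refine ext_insertLast fun y => ?_
    simp only [insertLast_formD, map_add, map_smul, ih, formD_theta, map_zero, pow_succ (-1 : ℝ) (n + 1)]
    module

/-! ### Symmetrization of the last pair and partial skew-symmetry. -/

/-- The anticommutator of two insertions, as an operator on forms. -/
def symLast {n : ℕ} (y z : g) : Form g (n + 2) →ₗ[ℝ] Form g n :=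
  insertLast y ∘ₗ insertLast z + insertLast z ∘ₗ insertLast y

theorem symLast_apply {n : ℕ} (y z : g) (α : Form g (n + 2)) :
    symLast y z α = insertLast y (insertLast z α) + insertLast z (insertLast y α) := rfl

/-- The `theta` terms of the two Cartan formulas have opposite signs and cancel after
symmetrization; the leftover insertions of `[y, z]` and `[z, y]` cancel by antisymmetry. -/
theorem symLast_formD {n : ℕ} (y z : g) (α : Form g (n + 2)) :
    symLast y z (formD α) = formD (symLast y z α) := by
  simp only [symLast_apply, insertLast_formD, insertLast_theta, map_add, map_smul,
    pow_succ (-1 : ℝ) (n + 1), ← lie_skew y z, map_neg, LinearMap.neg_apply]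
  module

theorem symLast_theta {n : ℕ} (y z w : g) (α : Form g (n + 2)) :
    symLast y z (theta w α) = theta w (symLast y z α) + symLast ⁅y, w⁆ z α
      + symLast y ⁅z, w⁆ α := by
  simp only [symLast_apply, insertLast_theta, map_add]
  abel

/-- The forms which change sign when two adjacent arguments are exchanged, for the last `k`
pairs of adjacent arguments, not counting the pair which contains the very first argument. -/
def skewLast (g : Type*) [LieRing g] [LieAlgebra ℝ g] : (k n : ℕ) → Submodule ℝ (Form g n)
  | k + 1, n + 3 => (⨅ y : g, ⨅ z : g, LinearMap.ker (symLast y z)) ⊓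
      ⨅ y : g, (skewLast g k (n + 2)).comap (insertLast y)
  -- With fewer than three arguments, no adjacent pair avoids the first one.
  | _, _ => ⊤

theorem mem_skewLast_zero {n : ℕ} (α : Form g n) : α ∈ skewLast g 0 n := by
  simp [skewLast]

theorem mem_skewLast_of_lt {k n : ℕ} (hn : n < 3) (α : Form g n) : α ∈ skewLast g k n := by
  match k, n with
  | 0, _ => exact mem_skewLast_zero α
  | _ + 1, 0 => exact Submodule.mem_top
  | _ + 1, 1 => exact Submodule.mem_top
  | _ + 1, 2 => exact Submodule.mem_top
  | _ + 1, n + 3 => omega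

theorem mem_skewLast_succ {k n : ℕ} {α : Form g (n + 3)} : α ∈ skewLast g (k + 1) (n + 3) ↔
    (∀ y z, symLast y z α = 0) ∧ ∀ y, insertLast y α ∈ skewLast g k (n + 2) := by
  simp [skewLast]

theorem insertLast_mem_skewLast {k n : ℕ} {α : Form g (n + 1)}
    (h : α ∈ skewLast g (k + 1) (n + 1)) (y : g) : insertLast y α ∈ skewLast g k n := by
  match n with
  | 0 => exact mem_skewLast_of_lt (by omega) _
  | 1 => exact mem_skewLast_of_lt (by omega) _
  | n + 2 => exact (mem_skewLast_succ.1 h).2 y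

/-- Only `n - 2` adjacent pairs avoid the first argument, so from `k = n - 2` on the condition is
stationary. -/
theorem mem_skewLast_of_le {k n : ℕ} (hn : n ≤ k + 2) {α : Form g n}
    (h : α ∈ skewLast g k n) : α ∈ skewLast g (k + 1) n := by
  induction k generalizing n with
  | zero => exact mem_skewLast_of_lt (by omega) α
  | succ k ih =>
    match n with
    | 0 | 1 | 2 => exact mem_skewLast_of_lt (by omega) α
    | n + 3 =>
      rw [mem_skewLast_succ] at h ⊢
      exact ⟨h.1, fun y => ih (by omega) (h.2 y)⟩

theorem mem_skewLast_of_succ {k n : ℕ} {α : Form g n} (h : α ∈ skewLast g (k + 1) n) :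
    α ∈ skewLast g k n := by
  induction k generalizing n with
  | zero => exact mem_skewLast_zero α
  | succ k ih =>
    match n with
    | 0 | 1 | 2 => exact mem_skewLast_of_lt (by omega) α
    | n + 3 =>
      rw [mem_skewLast_succ] at h ⊢
      exact ⟨h.1, fun y => ih (h.2 y)⟩

theorem theta_mem_skewLast {k n : ℕ} {α : Form g n} (h : α ∈ skewLast g k n) (w : g) :
    theta w α ∈ skewLast g k n := by
  induction k generalizing n with
  | zero => exact mem_skewLast_zero _
  | succ k ih =>
    match n with
    | 0 | 1 | 2 => exact mem_skewLast_of_lt (by omega) _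
    | n + 3 =>
      rw [mem_skewLast_succ] at h ⊢
      refine ⟨fun y z => ?_, fun y => ?_⟩
      · simp [symLast_theta, h.1]
      · rw [insertLast_theta]
        exact add_mem (ih (h.2 y)) (h.2 _)

/-! ### Correction of primitives by a splitting with parameters. -/

/-- The operator on forms which applies an operator of the family `T` to all arguments but the
last `b`, and treats these as parameters. -/
def liftForm (T : (n : ℕ) → Form g (n + 1) →ₗ[ℝ] Form g n) :
    (b n : ℕ) → Form g (n + 1) →ₗ[ℝ] Form g n
  | 0, n => T n
  | _ + 1, 0 => 0
  | b + 1, n + 1 => ofInsertLast ∘ₗ LinearMap.llcomp ℝ _ _ _ (liftForm T b n) ∘ₗ insertLast.flip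

variable (T : (n : ℕ) → Form g (n + 1) →ₗ[ℝ] Form g n)

theorem liftForm_zero (n : ℕ) : liftForm T 0 n = T n := by simp [liftForm]

theorem insertLast_liftForm (b n : ℕ) (y : g) (α : Form g (n + 2)) :
    insertLast y (liftForm T (b + 1) (n + 1) α) = liftForm T b n (insertLast y α) := by
  simp [liftForm]

theorem symLast_liftForm (b n : ℕ) (y z : g) (α : Form g (n + 3)) :
    symLast y z (liftForm T (b + 2) (n + 2) α) = liftForm T b n (symLast y z α) := by
  simp only [symLast_apply, map_add, insertLast_liftForm]

/-- The last `k` pairs occupy `k + 1 ≤ b` arguments, all of them parameters, so symmetrizing them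
passes through the linear operator. -/
theorem liftForm_mem_skewLast {k b n : ℕ} (hk : k < b) (hb : b ≤ n) {α : Form g (n + 1)}
    (h : α ∈ skewLast g k (n + 1)) : liftForm T b n α ∈ skewLast g k n := by
  induction k generalizing b n with
  | zero => exact mem_skewLast_zero _
  | succ k ih =>
    match n, b with
    | 0, _ | 1, _ | 2, _ => exact mem_skewLast_of_lt (by omega) _
    | n + 3, b + 2 =>
      rw [mem_skewLast_succ] at h ⊢
      refine ⟨fun y z => ?_, fun y => ?_⟩
      · rw [symLast_liftForm, h.1, map_zero]
      · rw [insertLast_liftForm]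
        exact ih (by omega) (by omega) (h.2 y)

/-- If `T` splits the coboundary on the cocycles of a family `C` of spaces of forms, then
`T` corrects a form in `C` which is skew-symmetric in its last `k + 1` arguments, and whose
coboundary is skew-symmetric in its last `k + 2` arguments, to a form with this property. -/
theorem sub_formD_liftForm_mem_skewLast {C : (n : ℕ) → Submodule ℝ (Form g n)}
    (hC : ∀ (n : ℕ) (y : g), ∀ α ∈ C (n + 1), insertLast y α ∈ C n)
    (hT : ∀ n, ∀ α ∈ C (n + 1), formD α = 0 → formD (T n α) = α)
    {k n : ℕ} (hn : k + 2 ≤ n) {α : Form g (n + 1)} (hα : α ∈ C (n + 1))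
    (h : α ∈ skewLast g k (n + 1)) (hd : formD α ∈ skewLast g (k + 1) (n + 2)) :
    α - formD (liftForm T (k + 2) n α) ∈ skewLast g (k + 1) (n + 1) := by
  induction k generalizing n with
  | zero =>
    obtain ⟨n, rfl⟩ : ∃ m, n = m + 2 := ⟨n - 2, by omega⟩
    refine mem_skewLast_succ.2 ⟨fun y z => ?_, fun y => mem_skewLast_zero _⟩
    -- Both arguments of the pair are parameters, so `T` acts on the symmetrization of `α`. That is
    -- a cocycle because `formD α` is skew in this pair.
    rw [map_sub, symLast_formD, symLast_liftForm, liftForm_zero, hT, sub_self]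
    · exact add_mem (hC _ _ _ (hC _ _ _ hα)) (hC _ _ _ (hC _ _ _ hα))
    · rw [← symLast_formD, (mem_skewLast_succ.1 hd).1]
  | succ k ih =>
    obtain ⟨n, rfl⟩ : ∃ m, n = m + 2 := ⟨n - 2, by omega⟩
    have hs := (mem_skewLast_succ.1 h).1
    refine mem_skewLast_succ.2 ⟨fun y z => ?_, fun y => ?_⟩
    · rw [map_sub, symLast_formD, symLast_liftForm, hs, map_zero, map_zero, sub_zero]
    -- Insertion produces the same correction for `insertLast y α`, with one parameter fewer, and a
    -- `theta` term that is already skew. Since insertion does not preserve cocycles, the induction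
    -- assumes only that `formD α` is skew.
    · rw [map_sub, insertLast_formD, insertLast_liftForm, ← sub_sub]
      refine sub_mem (ih (by omega) (hC _ _ _ hα) (insertLast_mem_skewLast h y) ?_)
        (Submodule.smul_mem _ _ (theta_mem_skewLast (liftForm_mem_skewLast T ?_ hn h) y))
      · have hy := insertLast_mem_skewLast hd y
        rw [insertLast_formD] at hy
        exact (Submodule.add_mem_iff_left _
          (Submodule.smul_mem _ _ (theta_mem_skewLast h y))).1 hy
      · omega

/-- A space of forms in each degree which is stable under the coboundary, whose cocycles of
positive degree are coboundaries, remains so after restriction to partially skew-symmetric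
forms. -/
theorem exists_formD_eq_of_mem_skewLast {C : (n : ℕ) → Submodule ℝ (Form g n)}
    (hC : ∀ (n : ℕ) (y : g), ∀ α ∈ C (n + 1), insertLast y α ∈ C n)
    (hd : ∀ n, ∀ α ∈ C n, formD α ∈ C (n + 1))
    (hT : ∀ n, ∀ α ∈ C (n + 1), formD α = 0 → formD (T n α) = α)
    (hTC : ∀ b n, ∀ α ∈ C (n + 1), liftForm T b n α ∈ C n)
    (k : ℕ) {n : ℕ} {α : Form g (n + 1)} (hα : α ∈ C (n + 1))
    (h : α ∈ skewLast g k (n + 1)) (hα0 : formD α = 0) :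
    ∃ e ∈ C n, e ∈ skewLast g k n ∧ formD e = α := by
  induction k with
  | zero => exact ⟨T n α, liftForm_zero T n ▸ hTC 0 n α hα, mem_skewLast_zero _, hT n α hα hα0⟩
  | succ k ih =>
    obtain ⟨e, he, hek, rfl⟩ := ih (mem_skewLast_of_succ h)
    -- In low degree there is no new pair; otherwise the form to be split has positive degree.
    rcases le_or_gt n (k + 2) with hn | hn
    · exact ⟨e, he, mem_skewLast_of_le hn hek, rfl⟩
    · obtain ⟨n, rfl⟩ : ∃ m, n = m + 1 := ⟨n - 1, by omega⟩
      refine ⟨e - formD (liftForm T (k + 2) n e), sub_mem he (hd _ _ (hTC _ _ _ he)),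
        sub_formD_liftForm_mem_skewLast T hC hT (by omega) he hek h, ?_⟩
      rw [map_sub, formD_formD, sub_zero]

end LastArgument

/-! ### Continuous multilinear forms have finite rank. -/

section FiniteRank

variable {E : Type*} [AddCommGroup E] [Module ℝ E]

theorem finiteDimensional_quotient_inf {N P : Submodule ℝ E} (hN : FiniteDimensional ℝ (E ⧸ N))
    (hP : FiniteDimensional ℝ (E ⧸ P)) : FiniteDimensional ℝ (E ⧸ (N ⊓ P)) := by
  have h : LinearMap.ker (N.mkQ.prod P.mkQ) = N ⊓ P := by
    rw [LinearMap.ker_prod, Submodule.ker_mkQ, Submodule.ker_mkQ]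
  rw [← h]
  exact (LinearMap.quotKerEquivRange (N.mkQ.prod P.mkQ)).symm.finiteDimensional

theorem finiteDimensional_quotient_iInf {κ : Type*} [Finite κ] {N : κ → Submodule ℝ E}
    (hN : ∀ i, FiniteDimensional ℝ (E ⧸ N i)) : FiniteDimensional ℝ (E ⧸ ⨅ i, N i) := by
  cases nonempty_fintype κ
  have h : LinearMap.ker (LinearMap.pi fun i => (N i).mkQ) = ⨅ i, N i := by
    simp [LinearMap.ker_pi]
  rw [← h]
  exact (LinearMap.quotKerEquivRange (LinearMap.pi fun i => (N i).mkQ)).symm.finiteDimensional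

variable [TopologicalSpace E] {ι : Type*} [Fintype ι] [DecidableEq ι]

/-- If every neighbourhood of `0` contains a subspace of finite codimension, then a continuous
multilinear form vanishes as soon as all its arguments outside a proper subset `A ∪ S`
lie in a suitable subspace of finite codimension. Here the arguments in `A` are prescribed,
and those in `S` are arbitrary. -/
theorem exists_finiteCodim_forall_eq_zero_of_subset
    (hE : ∀ U ∈ 𝓝 (0 : E), ∃ N : Submodule ℝ E, FiniteDimensional ℝ (E ⧸ N) ∧ (N : Set E) ⊆ U)
    (α : MultilinearMap ℝ (fun _ : ι => E) ℝ) (hα : Continuous α) (S : Finset ι) :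
    ∀ (A : Finset ι) (c : ι → E), A ∪ S ≠ Finset.univ →
      ∃ N : Submodule ℝ E, FiniteDimensional ℝ (E ⧸ N) ∧
        ∀ x : ι → E, (∀ i ∈ A, x i = c i) → (∀ i, i ∉ A → i ∉ S → x i ∈ N) → α x = 0 := by
  induction S using Finset.induction_on with
  | empty =>
    intro A c hA
    obtain ⟨t, ht⟩ : ∃ t, t ∉ A := by
      by_contra! h
      exact hA (by ext i; simp [h i])
    let z : ι → E := A.piecewise c 0
    have hz : α z = 0 := α.map_coord_zero t (by simp [z, ht])
    have hU : {x | |α x| < 1} ∈ 𝓝 z := by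
      refine (hα.abs.continuousAt (x := z)).eventually_lt continuousAt_const ?_
      simp [hz]
    rw [nhds_pi, Filter.mem_pi] at hU
    obtain ⟨I, -, V, hV, hVU⟩ := hU
    have hW : (⋂ i : {i // i ∉ A}, V i) ∈ 𝓝 (0 : E) := by
      refine Filter.iInter_mem.2 fun i => ?_
      simpa [z, i.2] using hV i
    obtain ⟨N, hN, hNW⟩ := hE _ hW
    refine ⟨N, hN, fun x hxA hxN => ?_⟩
    -- The coordinate `t` may be rescaled freely inside `N`, so all multiples of `α x` stay bounded,
    -- which forces `α x = 0`.
    have hlt : ∀ r : ℝ, |r * α x| < 1 := fun r => by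
      have h : Function.update x t (r • x t) ∈ {x | |α x| < 1} := hVU fun i _ => by
        by_cases hi : i ∈ A
        · rw [Function.update_of_ne (fun h : i = t => ht (h ▸ hi)), hxA i hi]
          simpa [z, hi] using mem_of_mem_nhds (hV i)
        · have hm : Function.update x t (r • x t) i ∈ N := by
            rcases eq_or_ne i t with rfl | hit
            · simpa using N.smul_mem r (hxN i hi (by simp))
            · simpa [hit] using hxN i hi (by simp)
          exact Set.mem_iInter.1 (hNW hm) ⟨i, hi⟩
      simpa [α.map_update_smul] using h
    by_contra h0
    have := hlt (α x)⁻¹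
    simp [h0] at this
  | insert t S htS ih =>
    intro A c hA
    by_cases htA : t ∈ A
    · obtain ⟨N, hN, h⟩ := ih A c (fun h => hA (by rw [Finset.union_insert, h]; simp))
      refine ⟨N, hN, fun x h1 h2 => h x h1 fun i hi hiS => h2 i hi ?_⟩
      rw [Finset.mem_insert, not_or]
      exact ⟨fun h => hi (h ▸ htA), hiS⟩
    · obtain ⟨N, hN, h⟩ := ih A c (fun h => hA (by rw [Finset.union_insert, h]; simp))
      -- Split the free argument at `t` along `N ⊕ F`. On `N` the subspace already found suffices;
      -- on the finite-dimensional `F` it is enough to prescribe each basis vector at `t` and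
      -- intersect the resulting subspaces.
      obtain ⟨F, hF⟩ := N.exists_isCompl
      have hFd : FiniteDimensional ℝ F := (N.quotientEquivOfIsCompl F hF).finiteDimensional
      let b := Module.finBasis ℝ F
      have hP := fun s => ih (insert t A) (Function.update c t (b s : E))
        (by rwa [Finset.insert_union, ← Finset.union_insert])
      choose P hPd hP using hP
      refine ⟨N ⊓ ⨅ s, P s,
        finiteDimensional_quotient_inf hN (finiteDimensional_quotient_iInf hPd),
        fun x hxA hxN => ?_⟩
      have hxN' : ∀ i, i ∉ A → i ∉ S → i ≠ t → x i ∈ N ⊓ ⨅ s, P s := fun i hiA hiS hit =>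
        hxN i hiA (by simp [hit, hiS])
      have key : LinearMap.ker (α.toLinearMap x t) = ⊤ := by
        rw [eq_top_iff, ← hF.sup_eq_top, sup_le_iff]
        refine ⟨fun n hn => ?_, ?_⟩
        · refine h _ (fun i hi => ?_) fun i hiA hiS => ?_
          · rw [Function.update_of_ne (fun h : i = t => htA (h ▸ hi)), hxA i hi]
          · rcases eq_or_ne i t with rfl | hit
            · simpa using hn
            · simpa [hit] using (hxN' i hiA hiS hit).1
        · have hb : (α.toLinearMap x t).comp F.subtype = 0 := b.ext fun s => by
            refine hP s _ (fun i hi => ?_) fun i hiA hiS => ?_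
            · rcases Finset.mem_insert.1 hi with rfl | hi
              · simp
              · have hit : i ≠ t := fun h => htA (h ▸ hi)
                simp [hit, hxA i hi]
            · rw [Finset.mem_insert, not_or] at hiA
              simpa [hiA.1] using (Submodule.mem_iInf _).1 (hxN' i hiA.2 hiS hiA.1).2 s
          exact fun f hf => LinearMap.congr_fun hb ⟨f, hf⟩
      have hx : x t ∈ LinearMap.ker (α.toLinearMap x t) := key ▸ Submodule.mem_top
      simpa using hx

/-- If every neighbourhood of `0` contains a subspace of finite codimension, then a continuous
multilinear form factors through a finite-dimensional quotient. -/
theorem exists_eq_compLinearMap_mkQ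
    (hE : ∀ U ∈ 𝓝 (0 : E), ∃ N : Submodule ℝ E, FiniteDimensional ℝ (E ⧸ N) ∧ (N : Set E) ⊆ U)
    (α : MultilinearMap ℝ (fun _ : ι => E) ℝ) (hα : Continuous α) :
    ∃ N : Submodule ℝ E, FiniteDimensional ℝ (E ⧸ N) ∧
      ∃ β : MultilinearMap ℝ (fun _ : ι => E ⧸ N) ℝ, α = β.compLinearMap fun _ => N.mkQ := by
  have h := fun t : ι => exists_finiteCodim_forall_eq_zero_of_subset hE α hα
    (Finset.univ.erase t) ∅ 0 (by
      rw [Finset.empty_union]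
      exact fun h => Finset.notMem_erase t Finset.univ (h.symm ▸ Finset.mem_univ t :))
  choose N hN h using h
  have hzero : ∀ x t, x t ∈ ⨅ t, N t → α x = 0 := fun x t hx =>
    h t x (by simp) fun i _ hi => by
      obtain rfl : i = t := by simpa using hi
      exact (Submodule.mem_iInf _).1 hx i
  obtain ⟨σ, hσ⟩ := (⨅ t, N t).mkQ.exists_rightInverse_of_surjective (Submodule.range_mkQ _)
  refine ⟨⨅ t, N t, finiteDimensional_quotient_iInf hN, α.compLinearMap fun _ => σ, ?_⟩
  ext x
  -- Replace the arguments one at a time by their representatives; each change lies in the common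
  -- subspace, where `α` vanishes.
  have hS : ∀ S : Finset ι,
      α (S.piecewise (fun i => σ ((⨅ t, N t).mkQ (x i))) x) = α x := fun S => by
    induction S using Finset.induction_on with
    | empty => simp
    | insert t S htS ih =>
      rw [Finset.piecewise_insert, ← ih, ← sub_eq_zero]
      set y := S.piecewise (fun i => σ ((⨅ t, N t).mkQ (x i))) x with hy
      have hyt : y t = x t := by simp [hy, htS]
      conv_lhs => rw [← Function.update_eq_self t y]
      rw [Function.update_idem, ← α.map_update_sub]
      refine hzero _ t ?_
      rw [Function.update_self, hyt, ← Submodule.Quotient.eq]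
      exact LinearMap.congr_fun hσ _
  simpa using (hS Finset.univ).symm

end FiniteRank

/-! ### Auxiliary facts on continuity, linear splittings and quotients. -/

/-- A linear map from a finite-dimensional space of functions is continuous for the topology
of pointwise convergence. -/
theorem continuous_eval_of_finiteDimensional {V X Y Z : Type*} [AddCommGroup V] [Module ℝ V]
    [FiniteDimensional ℝ V] [TopologicalSpace Y] [TopologicalSpace Z] (ev : V →ₗ[ℝ] X → ℝ)
    (hev : Function.Injective ev) (τ : V →ₗ[ℝ] Z → ℝ) (hτ : ∀ v, Continuous (τ v)) {γ : Y → V}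
    (hγ : ∀ x, Continuous fun y => ev (γ y) x) :
    Continuous fun p : Y × Z => τ (γ p.1) p.2 := by
  let e := LinearEquiv.ofInjective ev hev
  have : FiniteDimensional ℝ (LinearMap.range ev) := e.finiteDimensional
  have h2 : Continuous fun y => e (γ y) :=
    Continuous.subtype_mk (f := fun y => ev (γ y)) (continuous_pi hγ) _
  let v := Module.finBasis ℝ V
  have hc : ∀ t, Continuous fun y => v.coord t (γ y) := fun t => by
    have h1 : Continuous (v.coord t ∘ₗ e.symm.toLinearMap) :=
      LinearMap.continuous_of_finiteDimensional _
    refine (h1.comp h2).congr fun y => ?_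
    simp
  have he : ∀ p : Y × Z, τ (γ p.1) p.2 = ∑ t, v.coord t (γ p.1) * τ (v t) p.2 := fun p => by
    have h := congrArg (fun w => τ w p.2) (v.sum_repr (γ p.1)).symm
    simpa only [map_sum, map_smul, Finset.sum_apply, Pi.smul_apply, smul_eq_mul,
      Module.Basis.coord_apply] using h
  simp_rw [he]
  exact continuous_finsetSum _ fun t _ =>
    ((hc t).comp continuous_fst).mul ((hτ _).comp continuous_snd)

theorem exists_linearMap_apply_eq_of_mem_range {A B : Type*} [AddCommGroup A] [Module ℝ A]
    [AddCommGroup B] [Module ℝ B] (D : A →ₗ[ℝ] B) :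
    ∃ T : B →ₗ[ℝ] A, ∀ x ∈ LinearMap.range D, D (T x) = x := by
  obtain ⟨s, hs⟩ := D.rangeRestrict.exists_rightInverse_of_surjective D.range_rangeRestrict
  obtain ⟨t, ht⟩ := LinearMap.exists_extend s
  refine ⟨t, fun x hx => ?_⟩
  have h1 : t x = s ⟨x, hx⟩ := LinearMap.congr_fun ht ⟨x, hx⟩
  rw [h1]
  exact congrArg Subtype.val (LinearMap.congr_fun hs ⟨x, hx⟩)

theorem continuous_snoc {E : Type*} [TopologicalSpace E] {n : ℕ} :
    Continuous fun p : (Fin n → E) × E => (Fin.snoc p.1 p.2 : Fin (n + 1) → E) := by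
  refine continuous_pi fun i => ?_
  refine Fin.lastCases ?_ (fun i => ?_) i
  · simpa using continuous_snd
  · simpa [Function.comp_def] using (continuous_apply i).comp continuous_fst

theorem subsingleton_cohomologyQuotient_iff {C : Type*} [AddCommGroup C] [Module ℝ C]
    (Z B : Submodule ℝ C) : Subsingleton (CohomologyQuotient Z B) ↔ Z ≤ B := by
  rw [Submodule.Quotient.subsingleton_iff, Submodule.submoduleOf_eq_top]

/-! ### Continuous forms, and continuity of the parametrized splitting. -/

section Continuity

universe u

variable {g : Type u} [LieRing g] [LieAlgebra ℝ g] [TopologicalSpace g]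

/-- The continuous forms. -/
def contForm (g : Type*) [LieRing g] [LieAlgebra ℝ g] [TopologicalSpace g] (n : ℕ) :
    Submodule ℝ (Form g n) where
  carrier := {α | Continuous α}
  add_mem' {a b} ha hb := by
    exact Continuous.add (show Continuous a from ha) hb
  zero_mem' := (continuous_const : Continuous fun _ : Fin n → g => (0 : ℝ))
  smul_mem' r a ha := by
    exact Continuous.const_smul (show Continuous a from ha) r

theorem mem_contForm {n : ℕ} {α : Form g n} : α ∈ contForm g n ↔ Continuous α := Iff.rfl

theorem insertLast_mem_contForm (n : ℕ) (y : g) (α : Form g (n + 1))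
    (h : α ∈ contForm g (n + 1)) : insertLast y α ∈ contForm g n :=
  (mem_contForm.1 h).comp
    (continuous_snoc.comp (continuous_id.prodMk continuous_const) : Continuous fun x : Fin n → g =>
      (Fin.snoc x y : Fin (n + 1) → g))

theorem formD_mem_contForm [ContinuousLieBracket g] (n : ℕ) (α : Form g n)
    (h : α ∈ contForm g n) : formD α ∈ contForm g (n + 1) :=
  (leibnizD g n ⟨α, h⟩).cont

/-- If the Leibniz cohomology vanishes, then the coboundary splits over the cocycles. -/
theorem exists_splitting [ContinuousLieBracket g]
    (hHL : ∀ n : ℕ, 1 ≤ n → Subsingleton (LeibnizCohomology g n)) (n : ℕ) :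
    ∃ T : Form g (n + 1) →ₗ[ℝ] Form g n, (∀ α, T α ∈ contForm g n) ∧
      ∀ α ∈ contForm g (n + 1), formD α = 0 → formD (T α) = α := by
  -- Restricting the source makes every value of the splitting continuous; the splitting itself is
  -- defined on all forms and carries no continuity.
  let D : contForm g n →ₗ[ℝ] Form g (n + 1) := formD ∘ₗ (contForm g n).subtype
  obtain ⟨t, ht⟩ := exists_linearMap_apply_eq_of_mem_range (A := contForm g n)
    (B := Form g (n + 1)) D
  refine ⟨(contForm g n).subtype ∘ₗ t, fun α => (t α).2, fun α hα h0 => ht α ?_⟩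
  obtain ⟨e, he⟩ := (subsingleton_cohomologyQuotient_iff _ _).1 (hHL (n + 1) (by omega)) (x := (⟨α, hα⟩ : LeibnizCochain g (n + 1)))
    (ContinuousMultilinearMap.toMultilinearMap_injective h0)
  exact ⟨⟨e.toMultilinearMap, e.cont⟩, congrArg (fun a => a.toMultilinearMap) he⟩

/-- The parameter space `Y` makes the induction on `b` possible: each parameter argument moves into
`Y`. When none is left, the family lies in the finite-dimensional space of forms pulled back from `g
⧸ N`, so its coordinates, and hence its image under `T`, depend continuously on `Y`. -/
theorem continuous_liftForm_of_factors {T : (n : ℕ) → Form g (n + 1) →ₗ[ℝ] Form g n}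
    (hT : ∀ n α, T n α ∈ contForm g n) (N : Submodule ℝ g) [FiniteDimensional ℝ (g ⧸ N)]
    (b n : ℕ) {Y : Type u} [TopologicalSpace Y] (γ : Y → Form g (n + 1))
    (hγ : Continuous fun p : Y × (Fin (n + 1) → g) => γ p.1 p.2)
    (hN : ∀ y, ∃ β : MultilinearMap ℝ (fun _ : Fin (n + 1) => g ⧸ N) ℝ,
      γ y = β.compLinearMap fun _ => N.mkQ) :
    Continuous fun p : Y × (Fin n → g) => liftForm T b n (γ p.1) p.2 := by
  induction b generalizing n Y with
  | zero =>
    choose β hβ using hN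
    let pull : MultilinearMap ℝ (fun _ : Fin (n + 1) => g ⧸ N) ℝ →ₗ[ℝ] Form g (n + 1) :=
      MultilinearMap.compLinearMapₗ fun _ => N.mkQ
    let fn (m : ℕ) : Form g m →ₗ[ℝ] (Fin m → g) → ℝ :=
      { toFun := fun α => α, map_add' := fun _ _ => rfl, map_smul' := fun _ _ => rfl }
    have hinj : Function.Injective (fn (n + 1) ∘ₗ pull) := fun a b h =>
      MultilinearMap.ext fun x => by
        obtain ⟨y, rfl⟩ : ∃ y : Fin (n + 1) → g, (fun i => N.mkQ (y i)) = x :=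
          ⟨fun i => (x i).out, funext fun i => Quotient.out_eq _⟩
        exact congrFun h y
    refine (continuous_eval_of_finiteDimensional (fn (n + 1) ∘ₗ pull) hinj
      (fn n ∘ₗ T n ∘ₗ pull) (fun v => hT n _) (γ := β) fun x => ?_).congr fun p => ?_
    · refine (hγ.comp (continuous_id.prodMk continuous_const : Continuous fun y => (y, x))).congr
        fun y => ?_
      exact congrArg (fun f : Form g (n + 1) => f x) (hβ y)
    · rw [liftForm_zero, hβ]
      rfl
  | succ b ih =>
    match n with
    | 0 =>
      exact (continuous_const : Continuous fun _ : Y × (Fin 0 → g) => (0 : ℝ))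
    | n + 1 =>
      have h := ih n (Y := Y × g) (fun q => insertLast q.2 (γ q.1)) (by
          refine hγ.comp (f := fun p : (Y × g) × (Fin (n + 1) → g) =>
            (p.1.1, (Fin.snoc p.2 p.1.2 : Fin (n + 2) → g))) ?_
          exact (continuous_fst.comp continuous_fst).prodMk
            (continuous_snoc.comp (continuous_snd.prodMk (continuous_snd.comp continuous_fst))))
        (fun q => by
          obtain ⟨β, hβ⟩ := hN q.1
          refine ⟨(LinearMap.applyₗ (N.mkQ q.2) : ((g ⧸ N) →ₗ[ℝ] ℝ) →ₗ[ℝ] ℝ).compMultilinearMap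
            β.curryRight, ?_⟩
          ext x
          rw [hβ, insertLast_apply]
          simp only [MultilinearMap.compLinearMap_apply, LinearMap.compMultilinearMap_apply,
            LinearMap.applyₗ_apply_apply, MultilinearMap.curryRight_apply]
          refine congrArg β (funext fun i => ?_)
          refine Fin.lastCases ?_ (fun i => ?_) i <;> simp)
      have hq : Continuous fun p : Y × (Fin (n + 1) → g) =>
          (((p.1, p.2 (Fin.last n)), Fin.init p.2) : (Y × g) × (Fin n → g)) := by
        refine (continuous_fst.prodMk ((continuous_apply _).comp continuous_snd)).prodMk ?_
        exact continuous_pi fun i => (continuous_apply i.castSucc).comp continuous_snd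
      refine (h.comp hq).congr fun p => ?_
      rw [apply_eq_insertLast (liftForm T (b + 1) (n + 1) (γ p.1)), insertLast_liftForm]
      rfl

theorem liftForm_mem_contForm {T : (n : ℕ) → Form g (n + 1) →ₗ[ℝ] Form g n}
    (hT : ∀ n α, T n α ∈ contForm g n)
    (hg : DiscreteTopology g ∨
      ∀ U ∈ 𝓝 (0 : g), ∃ N : Submodule ℝ g, FiniteDimensional ℝ (g ⧸ N) ∧ (N : Set g) ⊆ U)
    (b n : ℕ) (α : Form g (n + 1)) (hα : α ∈ contForm g (n + 1)) :
    liftForm T b n α ∈ contForm g n := by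
  rcases hg with hg | hg
  · exact mem_contForm.2 continuous_of_discreteTopology
  · obtain ⟨N, hN, hβ⟩ := exists_eq_compLinearMap_mkQ hg α hα
    have h := continuous_liftForm_of_factors hT N b n (fun _ : PUnit.{u + 1} => α)
      ((mem_contForm.1 hα).comp continuous_snd) (fun _ => hβ)
    exact h.comp (continuous_const.prodMk continuous_id : Continuous fun x => (PUnit.unit, x))

end Continuity

/-! ### From adjacent transpositions to full skew-symmetry. -/

section Alternating

variable {g : Type*} [LieRing g] [LieAlgebra ℝ g]

theorem snoc_comp_swap_castSucc {A : Type*} {n : ℕ} (x : Fin n → A) (y : A) (p q : Fin n) :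
    (Fin.snoc x y : Fin (n + 1) → A) ∘ Equiv.swap p.castSucc q.castSucc
      = (Fin.snoc (x ∘ Equiv.swap p q) y : Fin (n + 1) → A) := by
  funext k
  refine Fin.lastCases ?_ (fun k => ?_) k
  · have hp : Fin.last n ≠ p.castSucc := (Fin.castSucc_lt_last p).ne'
    have hq : Fin.last n ≠ q.castSucc := (Fin.castSucc_lt_last q).ne'
    simp [Equiv.swap_apply_of_ne_of_ne hp hq]
  · have h := (Fin.castSucc_injective n).swap_apply p q k
    rw [Function.comp_apply, h, Fin.snoc_castSucc, Fin.snoc_castSucc, Function.comp_apply]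

theorem snoc_snoc_comp_swap {A : Type*} {n : ℕ} (x : Fin n → A) (y z : A) :
    (Fin.snoc (Fin.snoc x y : Fin (n + 1) → A) z : Fin (n + 2) → A)
        ∘ Equiv.swap (Fin.last n).castSucc (Fin.last (n + 1))
      = (Fin.snoc (Fin.snoc x z : Fin (n + 1) → A) y : Fin (n + 2) → A) := by
  funext k
  refine Fin.lastCases ?_ (fun k => Fin.lastCases ?_ (fun k => ?_) k) k
  · simp
  · simp
  · have h1 : k.castSucc.castSucc ≠ (Fin.last n).castSucc := fun h =>
      (Fin.castSucc_lt_last k).ne (Fin.castSucc_injective _ h)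
    have h2 : k.castSucc.castSucc ≠ Fin.last (n + 1) := (Fin.castSucc_lt_last _).ne
    simp [Equiv.swap_apply_of_ne_of_ne h1 h2]

theorem mem_skewLast_of_swap {n : ℕ} {α : Form g n}
    (h : ∀ p q : Fin n, p ≠ q → (p : ℕ) ≠ 0 → (q : ℕ) ≠ 0 → ∀ x, α (x ∘ Equiv.swap p q) = -α x)
    (k : ℕ) : α ∈ skewLast g k n := by
  induction k generalizing n with
  | zero => exact mem_skewLast_zero α
  | succ k ih =>
    match n with
    | 0 | 1 | 2 => exact mem_skewLast_of_lt (by omega) α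
    | n + 3 =>
      refine mem_skewLast_succ.2 ⟨fun y z => ?_, fun y => ih fun p q hpq hp hq x => ?_⟩
      · ext x
        simp only [symLast_apply, add_apply, insertLast_apply, zero_apply]
        rw [← snoc_snoc_comp_swap, h _ _ (Fin.castSucc_lt_last _).ne (by simp) (by simp)]
        simp
      · rw [insertLast_apply, ← snoc_comp_swap_castSucc,
          h _ _ (fun e => hpq (Fin.castSucc_injective _ e)) hp hq, insertLast_apply]

/-- Positions count from `0`: `p ≠ 0` spares the first argument, and `n ≤ q + k` puts the pair `(q -
1, q)` among the last `k`. -/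
theorem apply_comp_swap_of_mem_skewLast {k n : ℕ} {α : Form g n} (h : α ∈ skewLast g k n)
    (p q : Fin n) (hp : (p : ℕ) ≠ 0) (hq : (q : ℕ) = p + 1) (hk : n ≤ q + k)
    (x : Fin n → g) : α (x ∘ Equiv.swap p q) = -α x := by
  induction k generalizing n with
  | zero => omega
  | succ k ih =>
    obtain ⟨n, rfl⟩ : ∃ m, n = m + 3 := ⟨n - 3, by omega⟩
    obtain ⟨p, rfl⟩ : ∃ p', p = Fin.castSucc p' := ⟨⟨p, by omega⟩, rfl⟩
    rw [← Fin.snoc_init_self x]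
    rcases Fin.eq_castSucc_or_eq_last q with ⟨q, rfl⟩ | rfl
    · rw [snoc_comp_swap_castSucc, ← insertLast_apply, ← insertLast_apply]
      exact ih (insertLast_mem_skewLast h _) p q hp hq (by simp at hk; omega) _
    · obtain rfl : p = Fin.last (n + 1) := Fin.ext (by simp at hq ⊢; omega)
      rw [← Fin.snoc_init_self (Fin.init x), snoc_snoc_comp_swap]
      have h0 := congrArg (fun f : Form g (n + 1) => f (Fin.init (Fin.init x)))
        ((mem_skewLast_succ.1 h).1 (x (Fin.last (n + 2))) (Fin.init x (Fin.last (n + 1))))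
      simp only [symLast_apply, add_apply, insertLast_apply, zero_apply] at h0
      linarith

theorem apply_comp_perm_of_adjacent {A : Type*} {n : ℕ} {f : (Fin n → A) → ℝ}
    (h : ∀ p q : Fin n, (q : ℕ) = p + 1 → ∀ x, f (x ∘ Equiv.swap p q) = -f x)
    (σ : Equiv.Perm (Fin n)) (x : Fin n → A) :
    f (x ∘ σ) = (Equiv.Perm.sign σ : ℤ) * f x := by
  match n with
  | 0 => simp [Subsingleton.elim σ 1]
  | n + 1 =>
    have hσ : σ ∈ Submonoid.closure
        (Set.range fun i : Fin n => Equiv.swap i.castSucc i.succ) := by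
      rw [Equiv.Perm.mclosure_swap_castSucc_succ]
      exact Submonoid.mem_top σ
    induction hσ using Submonoid.closure_induction generalizing x with
    | mem σ hσ =>
      obtain ⟨i, rfl⟩ := hσ
      simp only
      rw [h _ _ (by simp), Equiv.Perm.sign_swap (Fin.castSucc_lt_succ).ne]
      simp
    | one => simp
    | mul σ τ _ _ hσ hτ =>
      rw [Equiv.Perm.coe_mul, ← Function.comp_assoc, hτ, hσ, Equiv.Perm.sign_mul]
      push_cast
      ring

theorem apply_eq_zero_of_adjacent {A : Type*} {n : ℕ} {f : (Fin n → A) → ℝ}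
    (h : ∀ p q : Fin n, (q : ℕ) = p + 1 → ∀ x, f (x ∘ Equiv.swap p q) = -f x)
    (x : Fin n → A) {i j : Fin n} (hx : x i = x j) (hij : i ≠ j) : f x = 0 := by
  have h1 := apply_comp_perm_of_adjacent h (Equiv.swap i j) x
  have h2 : x ∘ Equiv.swap i j = x := by
    funext k
    rcases eq_or_ne k i with rfl | hi
    · simp [hx]
    · rcases eq_or_ne k j with rfl | hj
      · simp [hx]
      · simp [Equiv.swap_apply_of_ne_of_ne hi hj]
  rw [h2, Equiv.Perm.sign_swap hij] at h1
  push_cast at h1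
  linarith

end Alternating

/-! ### Coadjoint cochains as partially skew forms. -/

section Coadjoint

theorem continuous_cons {E : Type*} [TopologicalSpace E] {n : ℕ} :
    Continuous fun p : E × (Fin n → E) => (Fin.cons p.1 p.2 : Fin (n + 1) → E) := by
  refine continuous_pi fun i => ?_
  refine Fin.cases ?_ (fun i => ?_) i
  · simpa using continuous_fst
  · simpa [Function.comp_def] using (continuous_apply i).comp continuous_snd

variable {g : Type*} [LieRing g] [LieAlgebra ℝ g] [TopologicalSpace g]

/-- The form `(h, x₁, …, xₙ) ↦ β (x₁, …, xₙ) (h)`. -/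
def toForm {n : ℕ} (β : MultilinearMap ℝ (fun _ : Fin n => g) (ContDual g)) :
    Form g (n + 1) :=
  MultilinearMap.mk' (fun x => β (Fin.tail x) (x 0))
    (by
      intro m c x y
      refine Fin.cases ?_ (fun c => ?_) c
      · simp
      · simp [Fin.tail_update_succ, Function.update_of_ne (Fin.succ_ne_zero c).symm])
    (by
      intro m c r x
      refine Fin.cases ?_ (fun c => ?_) c
      · simp
      · simp [Fin.tail_update_succ, Function.update_of_ne (Fin.succ_ne_zero c).symm])

theorem toForm_apply {n : ℕ} (β : MultilinearMap ℝ (fun _ : Fin n => g) (ContDual g))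
    (x : Fin (n + 1) → g) : toForm β x = β (Fin.tail x) (x 0) := rfl

theorem toForm_cons {n : ℕ} (β : MultilinearMap ℝ (fun _ : Fin n => g) (ContDual g))
    (h : g) (x : Fin n → g) : toForm β (Fin.cons h x) = β x h := by
  simp [toForm_apply]

theorem toForm_injective {n : ℕ} : Function.Injective
    (toForm : MultilinearMap ℝ (fun _ : Fin n => g) (ContDual g) → Form g (n + 1)) :=
  fun β γ h => MultilinearMap.ext fun x => ContinuousLinearMap.ext fun y => by
    rw [← toForm_cons, h, toForm_cons]

/-- Under the identification of `g'`-valued cochains with forms, the Chevalley–Eilenberg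
coboundary corresponds to the negative of the Leibniz coboundary. -/
theorem formD_toForm [ContinuousLieBracket g] {n : ℕ} (β : g [⋀^Fin n]→ₗ[ℝ] ContDual g) :
    formD (toForm β.toMultilinearMap) = -toForm (lieD g n β) := by
  ext x
  obtain ⟨h, x, rfl⟩ : ∃ h y, x = Fin.cons h y := ⟨x 0, Fin.tail x, (Fin.cons_self_tail x).symm⟩
  have hl : lieD g n β x h = (∑ j : Fin (n + 1), (-1 : ℝ) ^ (j : ℕ) * β (j.removeNth x) ⁅h, x j⁆)
      + ∑ j : Fin (n + 1), ∑ i : Fin n, if i.castSucc < j then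
        (-1 : ℝ) ^ (j : ℕ) * β (Function.update (j.removeNth x) i ⁅x i.castSucc, x j⁆) h
      else 0 := by
    change (actionD (coadjoint g) β.toMultilinearMap x + bracketD β.toMultilinearMap x) h = _
    rw [actionD_apply, bracketD_apply]
    simp only [add_apply, sum_apply]
    congr 1
    refine Finset.sum_congr rfl fun j _ => Finset.sum_congr rfl fun i _ => ?_
    split_ifs <;> rfl
  -- The omitted index is never `0`, and shifting it by one gives the global sign. The terms with `i
  -- = 0` bracket `h` with `xⱼ`, which is the coadjoint action.
  rw [neg_apply, toForm_cons, hl, formD_apply, Fin.sum_univ_succ]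
  have h0 : ∀ i : Fin (n + 1), ¬ i.castSucc < 0 := fun i => by simp
  simp only [h0, if_false, Finset.sum_const_zero, zero_add, ← Finset.sum_add_distrib,
    ← Finset.sum_neg_distrib]
  refine Finset.sum_congr rfl fun j _ => ?_
  rw [Fin.sum_univ_succ, neg_add, ← Finset.sum_neg_distrib]
  congr 1
  · simp [removeNth_succ_cons, Fin.update_cons_zero, toForm_cons, pow_succ]
  · refine Finset.sum_congr rfl fun i _ => ?_
    have hij : i.succ.castSucc < j.succ ↔ i.castSucc < j := by
      rw [← Fin.succ_castSucc, Fin.succ_lt_succ_iff]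
    simp only [hij]
    split_ifs
    · rw [removeNth_succ_cons, ← Fin.succ_castSucc, Fin.cons_succ, Fin.cons_succ,
        ← Fin.cons_update, toForm_cons, Fin.val_succ, pow_succ]
      simp
    · simp

theorem toForm_mem_skewLast {n : ℕ} (β : g [⋀^Fin n]→ₗ[ℝ] ContDual g) (k : ℕ) :
    toForm β.toMultilinearMap ∈ skewLast g k (n + 1) := by
  refine mem_skewLast_of_swap (fun p q hpq hp hq x => ?_) k
  obtain ⟨p, rfl⟩ := Fin.exists_succ_eq.2 (fun h => hp (by simp [h]) : p ≠ 0)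
  obtain ⟨q, rfl⟩ := Fin.exists_succ_eq.2 (fun h => hq (by simp [h]) : q ≠ 0)
  have h0 : Equiv.swap p.succ q.succ 0 = 0 :=
    Equiv.swap_apply_of_ne_of_ne (Fin.succ_ne_zero p).symm (Fin.succ_ne_zero q).symm
  have ht : Fin.tail (x ∘ Equiv.swap p.succ q.succ) = Fin.tail x ∘ Equiv.swap p q := by
    funext k
    simp [Fin.tail, (Fin.succ_injective n).swap_apply]
  have hβ := β.map_swap (Fin.tail x) (fun h => hpq (congrArg Fin.succ h) : p ≠ q)
  rw [toForm_apply, toForm_apply, ht, Function.comp_apply, h0]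
  exact congrArg (fun f : ContDual g => f (x 0)) hβ

theorem toForm_mem_contForm_iff {n : ℕ} (β : g [⋀^Fin n]→ₗ[ℝ] ContDual g) :
    toForm β.toMultilinearMap ∈ contForm g (n + 1) ↔ β ∈ lieCochains g n := by
  constructor
  · intro h
    have hc : Continuous fun p : g × (Fin n → g) => (Fin.cons p.1 p.2 : Fin (n + 1) → g) :=
      continuous_cons
    refine ((mem_contForm.1 h).comp hc).congr fun p => ?_
    exact toForm_cons _ _ _
  · intro h
    have hc : Continuous fun x : Fin (n + 1) → g => (x 0, Fin.tail x) :=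
      (continuous_apply 0).prodMk (continuous_pi fun i => continuous_apply i.succ)
    exact Continuous.comp (g := fun p : g × (Fin n → g) => β p.2 p.1) h hc

/-- A continuous form which is skew-symmetric in all arguments but the first comes from a
continuous skew-symmetric `g'`-valued cochain. -/
theorem exists_toForm_eq {n : ℕ} {α : Form g (n + 1)} (hα : α ∈ contForm g (n + 1))
    (h : α ∈ skewLast g n (n + 1)) :
    ∃ β ∈ lieCochains g n, toForm β.toMultilinearMap = α := by
  have hswap : ∀ (y : g) (p q : Fin n), (q : ℕ) = p + 1 → ∀ x : Fin n → g,
      α (Fin.cons y (x ∘ Equiv.swap p q)) = -α (Fin.cons y x) := fun y p q hpq x => by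
    rw [← apply_comp_swap_of_mem_skewLast h p.succ q.succ (by simp) (by simp [hpq])
      (by simp)]
    refine congrArg α (funext fun k => ?_)
    refine Fin.cases ?_ (fun k => ?_) k
    · rw [Function.comp_apply, Equiv.swap_apply_of_ne_of_ne (Fin.succ_ne_zero p).symm
        (Fin.succ_ne_zero q).symm]
      rfl
    · simp [(Fin.succ_injective n).swap_apply]
  have hcons (x : Fin n → g) : Continuous fun y : g => α (Fin.cons y x) :=
    (mem_contForm.1 hα).comp (continuous_cons.comp (continuous_id.prodMk continuous_const) :
      Continuous fun y : g => (Fin.cons y x : Fin (n + 1) → g))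
  let β : g [⋀^Fin n]→ₗ[ℝ] ContDual g :=
    { toMultilinearMap := MultilinearMap.mk'
        (fun x =>
          { toFun := fun y => α (Fin.cons y x)
            map_add' := α.cons_add x
            map_smul' := fun r y => α.cons_smul x r y
            cont := hcons x })
        (fun m i y z => ContinuousLinearMap.ext fun w => by simp [Fin.cons_update])
        (fun m i r y => ContinuousLinearMap.ext fun w => by simp [Fin.cons_update])
      map_eq_zero_of_eq' := fun x i j hx hij => ContinuousLinearMap.ext fun y =>
        apply_eq_zero_of_adjacent (f := fun x => α (Fin.cons y x)) (hswap y) x hx hij }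
  have hβ : toForm β.toMultilinearMap = α := MultilinearMap.ext fun x => by
    rw [toForm_apply]
    change α (Fin.cons (x 0) (Fin.tail x)) = α x
    rw [Fin.cons_self_tail]
  exact ⟨β, (toForm_mem_contForm_iff β).1 (hβ.symm ▸ hα), hβ⟩

end Coadjoint

end LieLeibniz

/-! ### The main theorem. -/

theorem theorem3p6 (g : Type*) [LieRing g] [LieAlgebra ℝ g]
    [TopologicalSpace g] [IsTopologicalAddGroup g] [ContinuousLieBracket g]
    (hg : DiscreteTopology g ∨
      ∀ U ∈ 𝓝 (0 : g), ∃ N : Submodule ℝ g, FiniteDimensional ℝ (g ⧸ N) ∧ (N : Set g) ⊆ U)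
    (hHL : ∀ n : ℕ, 1 ≤ n → Subsingleton (LieLeibniz.LeibnizCohomology g n)) :
    ∀ n : ℕ, 1 ≤ n → Subsingleton (LieLeibniz.LieCohomologyCoadjoint g (n - 1)) := by
  open LieLeibniz in
  intro n _
  generalize n - 1 = n
  choose T hTc hT using exists_splitting hHL
  refine (subsingleton_cohomologyQuotient_iff _ _).2 fun β hβ => ?_
  obtain ⟨hβc, hβd⟩ := hβ
  have hd : formD (toForm β.toMultilinearMap) = 0 := by
    rw [formD_toForm, LinearMap.mem_ker.1 hβd]
    exact neg_eq_zero.2 rfl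
  obtain ⟨e, hec, hes, he⟩ := exists_formD_eq_of_mem_skewLast T insertLast_mem_contForm
    formD_mem_contForm hT (liftForm_mem_contForm hTc hg) n
    ((toForm_mem_contForm_iff β).2 hβc) (toForm_mem_skewLast β n) hd
  match n with
  | 0 =>
    -- The primitive is a constant, whose coboundary is zero, so the cocycle itself vanishes.
    rw [formD_form_zero] at he
    have h0 : β.toMultilinearMap = 0 := toForm_injective he.symm
    exact (Submodule.mem_bot ℝ).2 (AlternatingMap.ext fun x => DFunLike.congr_fun h0 x)
  | n + 1 =>
    -- The factor `-1` absorbs the sign between the two coboundaries.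
    obtain ⟨γ, hγc, hγ⟩ := exists_toForm_eq (Submodule.smul_mem _ (-1 : ℝ) hec)
      (Submodule.smul_mem _ (-1 : ℝ) (mem_skewLast_of_succ hes))
    refine ⟨γ, hγc, toForm_injective ?_⟩
    have h := congrArg formD hγ
    rw [formD_toForm, map_smul, he] at h
    exact neg_injective (h.trans (neg_one_smul ℝ (toForm β.toMultilinearMap)))
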